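/- Let $b\ge 1$ be a fixed integer, $\varepsilon>0$, $P_{\max}>0$, $N_0>0$. For each $N$ consider $N$ users and $K=bN$ channels. Let $g_{n,k}$ be the gain of user $n$ in channel $k$; all the gains are independent, and for each user $n$ the gains $g_{n,1},g_{n,2},\dots$ are identically distributed, with a law that may depend on $n$ and has an exponentially-dominated tail: its CDF $F_n$ is continuous and, for some $\alpha,\lambda,\gamma>0$ and $\beta\in\mathbb{R}$, $\lim_{x\to\infty}\frac{1-F_n(x)}{\alpha x^{\beta}e^{-\lambda x^{\gamma}}}=1$. Let $M=\lceil (b+1)(1+\varepsilon)\ln K\rceil$. A perfect matching allocation is a choice of pairwise disjoint sets of channels $\mathcal{A}_1,\dots,\mathcal{A}_N$ in which each $\mathcal{A}_n$ consists of $b$ of the $M$ best channels (those with the largest gains among the $K$) of user $n$. For each $N$ and each realization of the gains let $(\mathcal{A}_1,\dots,\mathcal{A}_N)$ be any allocation that is a perfect matching allocation whenever one exists. Put $$R_n=\sum_{k\in\mathcal{A}_n}\log_2\Bigl(1+\frac{g_{n,k}^2P_{\max}}{bN_0}\Bigr),\qquad R_n^{\mathrm{WF}}=\max\Bigl\{\sum_{k\in\mathcal{A}_n}\log_2\Bigl(1+\frac{g_{n,k}^2P_k}{N_0}\Bigr):\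 P_k\ge 0,\ \sum_{k\in\mathcal{A}_n}P_k\le P_{\max}\Bigr\},$$ the rates of user $n$ under equal power allocation and under optimal (water-filling) power allocation. Then for every user $n$ the ratio $R_n^{\mathrm{WF}}/R_n$ converges to $1$ in probability as $K=bN\to\infty$. If moreover only finitely many different laws occur among the users (for example, if all users have the same law), then the convergence is uniform over the users, that is, $\Pr\bigl(\exists\, n\le N:\ |R_n^{\mathrm{WF}}/R_n-1|\ge\delta\bigr)\to 0$ for every $\delta>0$, and the ratio of sum-rates $\sum_{n\le N}R_n^{\mathrm{WF}}\big/\sum_{n\le N}R_n$ converges to $1$ in probability. -/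

import Mathlib

open MeasureTheory ProbabilityTheory Filter Topology Finset

noncomputable section

namespace WaterFilling

/-- A probability law `ν` on the real line has an exponentially-dominated tail: its CDF `F` is
continuous and `(1 - F x) / (α x ^ β exp (-lam x ^ γ)) → 1` as `x → ∞`, for some `α, lam, γ > 0`
and some real `β`. -/
def HasExpDominatedTail (ν : Measure ℝ) : Prop :=
  Continuous (cdf ν) ∧
    ∃ α β lam γ : ℝ, 0 < α ∧ 0 < lam ∧ 0 < γ ∧
      Tendsto (fun x : ℝ => (1 - cdf ν x) / (α * x ^ β * Real.exp (-lam * x ^ γ))) atTop (𝓝 1)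

/-- For a user whose gains in the channels `0, …, K - 1` are `x 0, …, x (K - 1)`, channel `k` is
one of the `M` best: fewer than `M` of the channels have a strictly larger gain. (If no two gains
are equal and `M ≤ K`, there are exactly `M` such channels.) -/
def IsMBest (K M : ℕ) (x : ℕ → ℝ) (k : ℕ) : Prop :=
  k < K ∧ #{j ∈ range K | x k < x j} < M

/-- The allocation `A` of channels `0, …, b * N - 1` to users `0, …, N - 1` is a perfect matching
allocation with parameter `M` for the gains `x n k`: every user gets `b` channels, all of them
among his `M` best, and no channel is given to two users. -/
structure IsPMAllocation (b N M : ℕ) (x : ℕ → ℕ → ℝ) (A : ℕ → Finset ℕ) : Prop where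
  card_eq : ∀ n < N, #(A n) = b
  isMBest : ∀ n < N, ∀ k ∈ A n, IsMBest (b * N) M (x n) k
  disjoint : ∀ m < N, ∀ n < N, m ≠ n → Disjoint (A m) (A n)

/-- The number of best channels of each user that are fed back, `⌈(b + 1) (1 + ε) ln K⌉` with
`K = b N` channels. -/
def feedbackSize (b : ℕ) (ε : ℝ) (N : ℕ) : ℕ :=
  ⌈((b : ℝ) + 1) * (1 + ε) * Real.log ((b * N : ℕ) : ℝ)⌉₊

/-- Rate, in bits per channel use, of a user with channel gains `x`, channels `A`, transmission
power `P k` in channel `k` and noise variance `N₀`. -/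
def rate (N₀ : ℝ) (x : ℕ → ℝ) (A : Finset ℕ) (P : ℕ → ℝ) : ℝ :=
  ∑ k ∈ A, Real.logb 2 (1 + x k ^ 2 * P k / N₀)

/-- Rate under equal power `Pmax / b` in each of the `b` channels. -/
def equalPowerRate (b : ℕ) (Pmax N₀ : ℝ) (x : ℕ → ℝ) (A : Finset ℕ) : ℝ :=
  rate N₀ x A fun _ => Pmax / b

/-- The power allocations over the channels `A` that respect the power budget `Pmax`. -/
def feasiblePowers (Pmax : ℝ) (A : Finset ℕ) : Set (ℕ → ℝ) :=
  {P | (∀ k ∈ A, 0 ≤ P k) ∧ ∑ k ∈ A, P k ≤ Pmax}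

/-- The rate achieved by water-filling, that is, by an optimal division of the power budget `Pmax`
over the channels `A`. The supremum is a maximum, see `isGreatest_waterFillingRate`. -/
def waterFillingRate (Pmax N₀ : ℝ) (x : ℕ → ℝ) (A : Finset ℕ) : ℝ :=
  sSup (rate N₀ x A '' feasiblePowers Pmax A)

theorem isGreatest_waterFillingRate {Pmax N₀ : ℝ} (hP : 0 ≤ Pmax) (hN₀ : 0 < N₀) (x : ℕ → ℝ)
    (A : Finset ℕ) :
    IsGreatest (rate N₀ x A '' feasiblePowers Pmax A) (waterFillingRate Pmax N₀ x A) := by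
  set S : Set (ℕ → ℝ) := Set.univ.pi (fun _ => Set.Icc 0 Pmax) ∩ {P | ∑ k ∈ A, P k ≤ Pmax}
    with hS
  have hSc : IsCompact S := by
    refine (isCompact_univ_pi fun _ => isCompact_Icc).inter_right ?_
    exact isClosed_le (by fun_prop) (by fun_prop)
  have hSne : S.Nonempty := ⟨fun _ => 0, fun _ _ => ⟨le_rfl, hP⟩, by simpa using hP⟩
  have hcont : ContinuousOn (rate N₀ x A) S := by
    unfold rate
    refine continuousOn_finsetSum _ fun k _ => ?_
    simp only [Real.logb]
    refine ContinuousOn.div_const (ContinuousOn.log (by fun_prop) fun P hPS => ?_) _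
    have : 0 ≤ P k := (hPS.1 k (Set.mem_univ k)).1
    positivity
  have himg : rate N₀ x A '' feasiblePowers Pmax A = rate N₀ x A '' S := by
    ext r
    constructor
    · rintro ⟨P, ⟨h0, hs⟩, rfl⟩
      refine ⟨fun k => if k ∈ A then P k else 0, ⟨fun k _ => ?_, ?_⟩, ?_⟩
      · by_cases hk : k ∈ A
        · simp only [hk, if_true]
          exact ⟨h0 k hk, (single_le_sum h0 hk).trans hs⟩
        · simp [hk, hP]
      · show ∑ k ∈ A, (if k ∈ A then P k else 0) ≤ Pmax
        rwa [sum_congr rfl fun k hk => if_pos hk]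
      · unfold rate
        exact sum_congr rfl fun k hk => by simp [hk]
    · rintro ⟨P, ⟨h0, hs⟩, rfl⟩
      exact ⟨P, ⟨fun k _ => (h0 k (Set.mem_univ k)).1, hs⟩, rfl⟩
  unfold waterFillingRate
  rw [himg]
  exact (hSc.image_of_continuousOn hcont).isGreatest_sSup (hSne.image _)

end WaterFilling

end

/-! Water-filling gives a channel at most `b` times its equal share of power, so it gains at most `b
* logb 2 b` bits per user (`waterFillingRate_le`). This is negligible once the equal-power rate is
large, which holds as soon as all the user's channels have gain above a suitable constant `L`
(`exists_rate_threshold`). Two events must therefore have probability tending to one.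

A perfect matching allocation exists. If Hall's condition fails, the best sets of some `s` users all
lie in a set of `b * s - 1` channels. By exchangeability the best set of one user lies in a given
set of `t` of the `K` channels with probability at most `(t / K) ^ M`
(`measureReal_bestSet_subset_le`). Users are independent, and the union bound over users and
channels tends to zero for the given `M` (`unionBound_le`).

The `M` best gains exceed `L`. The tail never vanishes, so a positive fraction of the `K` gains is
expected above `L`, while `M` is only logarithmic. A Chernoff bound is strong enough to cover all
`N` users when their tail probabilities at `L` have a common positive lower bound
(`measureReal_card_lt_le`). -/

namespace WaterFilling

/-! ### The set of best channels of one user -/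

section BestSet

variable {ι : Type*} [Fintype ι]

/-- The indices at which fewer than `M` of the values of `x` are strictly larger. -/
noncomputable def bestSet (M : ℕ) (x : ι → ℝ) : Finset ι := {k | #{j | x k < x j} < M}

theorem mem_bestSet {M : ℕ} {x : ι → ℝ} {k : ι} : k ∈ bestSet M x ↔ #{j | x k < x j} < M := by
  simp [bestSet]

/-- The largest value outside the best set is beaten only by members of the set, and by at least `M`
of them. Ties can only enlarge the set. -/
theorem le_card_bestSet {M : ℕ} (hM : M ≤ Fintype.card ι) (x : ι → ℝ) : M ≤ #(bestSet M x) := by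
  classical
  by_contra! h
  have hne : (bestSet M x)ᶜ.Nonempty := by
    rw [← card_pos, card_compl]
    omega
  obtain ⟨j, hj, hmax⟩ := exists_max_image _ x hne
  rw [mem_compl, mem_bestSet, not_lt] at hj
  refine absurd (hj.trans (card_le_card fun i hi => ?_)) h.not_ge
  by_contra hi'
  exact absurd (hmax i (mem_compl.2 hi')) (not_le.2 (mem_filter.1 hi).2)

theorem bestSet_comp_perm (M : ℕ) (x : ι → ℝ) (σ : Equiv.Perm ι) (k : ι) :
    k ∈ bestSet M (x ∘ σ) ↔ σ k ∈ bestSet M x := by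
  rw [mem_bestSet, mem_bestSet]
  have : #{j | x (σ k) < x j} = #{j | (x ∘ σ) k < (x ∘ σ) j} := by
    symm
    refine card_bij (fun j _ => σ j) (by simp) (by simp) fun j hj => ?_
    exact ⟨σ.symm j, by simpa using hj, by simp⟩
  rw [this]

theorem measurableSet_bestSet_subset (M : ℕ) (T : Finset ι) :
    MeasurableSet {x : ι → ℝ | bestSet M x ⊆ T} := by
  have h1 : ∀ k, MeasurableSet {x : ι → ℝ | k ∈ bestSet M x} := fun k => by
    have h2 : Measurable fun x : ι → ℝ => #{j | x k < x j} := by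
      simp only [card_filter]
      refine Finset.measurable_sum _ fun j _ => Measurable.ite ?_ measurable_const measurable_const
      exact measurableSet_lt (measurable_pi_apply k) (measurable_pi_apply j)
    simp only [mem_bestSet]
    exact measurableSet_lt h2 measurable_const
  have h3 : {x : ι → ℝ | bestSet M x ⊆ T} = ⋂ k, {x | k ∈ bestSet M x → k ∈ T} := by
    ext x; simp [Finset.subset_iff]
  rw [h3]
  refine MeasurableSet.iInter fun k => ?_
  by_cases hk : k ∈ T
  · simp [hk]
  · simpa only [hk, imp_false] using! (h1 k).compl

end BestSet

/-! ### Exchangeability: a best set rarely lies in a small set -/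

theorem choose_sub_mul_pow_le (K t m : ℕ) (hm : m ≤ t) (ht : t ≤ K) :
    (K - m).choose (t - m) * K ^ m ≤ t ^ m * K.choose t := by
  induction m with
  | zero => simp
  | succ m ih =>
    have h1 : (K - m) * (K - (m + 1)).choose (t - (m + 1)) = (K - m).choose (t - m) * (t - m) := by
      obtain ⟨a, rfl⟩ := Nat.exists_eq_add_of_le hm
      obtain ⟨c, rfl⟩ := Nat.exists_eq_add_of_le ht
      have := Nat.add_one_mul_choose_eq (a + c) a
      rw [show m + 1 + a + c - m = a + c + 1 by omega, show m + 1 + a + c - (m + 1) = a + c by omega,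
        show m + 1 + a - m = a + 1 by omega, show m + 1 + a - (m + 1) = a by omega]
      exact this
    -- Each factor `(t - m) / (K - m)` of the ratio of binomials is at most `t / K`.
    have h2 : (t - m) * K ≤ t * (K - m) := by
      rw [Nat.sub_mul, Nat.mul_sub]
      have : t * m ≤ m * K := by rw [mul_comm]; exact Nat.mul_le_mul_left _ ht
      omega
    have h3 : 0 < K - m := by omega
    refine Nat.le_of_mul_le_mul_left ?_ h3
    calc (K - m) * ((K - (m + 1)).choose (t - (m + 1)) * K ^ (m + 1))
        = ((K - m) * (K - (m + 1)).choose (t - (m + 1))) * K * K ^ m := by ring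
      _ = (K - m).choose (t - m) * ((t - m) * K) * K ^ m := by rw [h1]; ring
      _ ≤ (K - m).choose (t - m) * (t * (K - m)) * K ^ m := by gcongr
      _ = t * (K - m) * ((K - m).choose (t - m) * K ^ m) := by ring
      _ ≤ t * (K - m) * (t ^ m * K.choose t) := by exact Nat.mul_le_mul_left _ (ih (by omega))
      _ = (K - m) * (t ^ (m + 1) * K.choose t) := by ring

section Exchangeable

variable {ι : Type*} [Fintype ι]

/-- Only an `M`-element subset `V` of `W` is used: a superset `T` of `V` is determined by `T \ V`, a
set of `t - M` points outside `V`. -/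
theorem card_superset_le [DecidableEq ι] {M t : ℕ} (ht : t ≤ Fintype.card ι) {W : Finset ι}
    (hW : M ≤ #W) :
    #{T ∈ powersetCard t univ | W ⊆ T} * Fintype.card ι ^ M ≤
      t ^ M * (Fintype.card ι).choose t := by
  obtain ⟨V, hVW, hV⟩ := exists_subset_card_eq hW
  by_cases hM : M ≤ t
  · refine le_trans (Nat.mul_le_mul_right _ ?_) (choose_sub_mul_pow_le _ t M hM ht)
    have : #(powersetCard (t - M) (univ \ V)) = (Fintype.card ι - M).choose (t - M) := by
      rw [card_powersetCard, card_sdiff_of_subset (subset_univ _), hV, card_univ]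
    rw [← this]
    refine card_le_card_of_injOn (fun T => T \ V) (fun T hT => ?_) fun T hT T' hT' h => ?_
    · simp only [coe_filter, mem_powersetCard, Set.mem_ofPred_eq] at hT
      simp only [mem_coe, mem_powersetCard]
      refine ⟨sdiff_subset_sdiff hT.1.1 le_rfl, ?_⟩
      rw [card_sdiff_of_subset (hVW.trans hT.2), hT.1.2, hV]
    · simp only [coe_filter, mem_powersetCard, Set.mem_ofPred_eq] at hT hT'
      rw [← sdiff_union_of_subset (hVW.trans hT.2), ← sdiff_union_of_subset (hVW.trans hT'.2)]
      exact congrArg (· ∪ V) h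
  · have : ({T ∈ powersetCard t univ | W ⊆ T} : Finset (Finset ι)) = ∅ := by
      refine filter_eq_empty_iff.2 fun T hT h => ?_
      have := card_le_card h
      rw [(mem_powersetCard.1 hT).2] at this
      omega
    simp [this]

/-- A permutation of the indices carrying `T` onto `T'` preserves the product measure and permutes
the best set accordingly. -/
theorem measureReal_bestSet_subset_eq (ν : Measure ℝ) [IsProbabilityMeasure ν] (M : ℕ)
    {T T' : Finset ι} (h : #T = #T') :
    (Measure.pi fun _ : ι => ν).real {x | bestSet M x ⊆ T} =
      (Measure.pi fun _ : ι => ν).real {x | bestSet M x ⊆ T'} := by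
  classical
  have e : {i // i ∈ T} ≃ {i // i ∈ T'} := Fintype.equivOfCardEq (by simpa using h)
  set σ := e.extendSubtype
  have hσ : ∀ k, σ k ∈ T' ↔ k ∈ T := fun k => by
    refine ⟨fun hk => ?_, fun hk => e.extendSubtype_mem k hk⟩
    by_contra hk'
    exact e.extendSubtype_not_mem k hk' hk
  have hmp : MeasurePreserving (fun x : ι → ℝ => x ∘ σ) (Measure.pi fun _ : ι => ν)
      (Measure.pi fun _ : ι => ν) := by
    have := measurePreserving_piCongrLeft (fun _ : ι => ν) σ.symm
    convert this using 1
    ext x i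
    obtain ⟨j, rfl⟩ := σ.symm.surjective i
    rw [MeasurableEquiv.coe_piCongrLeft, Equiv.piCongrLeft_apply_apply]
    simp
  rw [← hmp.measureReal_preimage (measurableSet_bestSet_subset M T).nullMeasurableSet]
  congr 1
  ext x
  simp only [Set.preimage_ofPred_eq, Set.mem_ofPred_eq, Finset.subset_iff, bestSet_comp_perm]
  refine ⟨fun H k hk => ?_, fun H k hk => (hσ k).1 (H hk)⟩
  have := H (x := σ.symm k) (by simpa using hk)
  simpa using (hσ _).2 this

/-- The set of the `M` best of `K` independent and identically distributed values lies in a given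
set of `t` indices with probability at most `(t / K) ^ M`. -/
theorem measureReal_bestSet_subset_le (ν : Measure ℝ) [IsProbabilityMeasure ν] {M : ℕ}
    (hM : M ≤ Fintype.card ι) (T : Finset ι) :
    (Measure.pi fun _ : ι => ν).real {x | bestSet M x ⊆ T} ≤
      ((#T : ℝ) / Fintype.card ι) ^ M := by
  classical
  set P := Measure.pi fun _ : ι => ν
  set K := Fintype.card ι
  have hTK : #T ≤ K := card_le_univ T
  rcases Nat.eq_zero_or_pos K with hK | hK
  · have : M = 0 := by omega
    simp [this]
  have hC : (0 : ℝ) < K.choose #T := by exact_mod_cast Nat.choose_pos hTK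
  -- All sets of size `#T` are equally likely to contain the best set, so the probability is an
  -- average over them, and the number of such sets containing it is bounded pointwise.
  have hsum : (K.choose #T : ℝ) * P.real {x | bestSet M x ⊆ T} =
      ∫ x, (#{S ∈ powersetCard #T univ | bestSet M x ⊆ S} : ℝ) ∂P := by
    have h1 : ∀ x : ι → ℝ, (#{S ∈ powersetCard #T univ | bestSet M x ⊆ S} : ℝ) =
        ∑ S ∈ powersetCard #T univ, {x | bestSet M x ⊆ S}.indicator (1 : (ι → ℝ) → ℝ) x :=
      fun x => by
        simp [Set.indicator_apply]
    simp_rw [h1]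
    rw [integral_finsetSum]
    · rw [sum_congr rfl fun S hS => by
        rw [integral_indicator_one (measurableSet_bestSet_subset M S),
          measureReal_bestSet_subset_eq ν M (mem_powersetCard.1 hS).2]]
      rw [sum_const, card_powersetCard, card_univ, nsmul_eq_mul]
    · intro S _
      exact (integrable_const (1 : ℝ)).indicator (measurableSet_bestSet_subset M S)
  have hle : (K.choose #T : ℝ) * P.real {x | bestSet M x ⊆ T} ≤
      ((#T : ℝ) / K) ^ M * K.choose #T := by
    rw [hsum]
    refine (integral_mono_of_nonneg (.of_forall fun x => by positivity)
      (integrable_const _) (.of_forall fun x => ?_)).trans_eq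
      (by simp : ∫ _, ((#T : ℝ) / K) ^ M * K.choose #T ∂P = _)
    have := card_superset_le hTK (le_card_bestSet hM x)
    dsimp only
    rw [div_pow, div_mul_eq_mul_div, le_div_iff₀ (by positivity)]
    exact_mod_cast this
  rw [mul_comm] at hle
  exact le_of_mul_le_mul_right hle hC

end Exchangeable

/-! ### Independence of the users and Hall's condition -/

theorem iIndepFun_curry {ι κ Ω 𝓧 : Type*} [MeasurableSpace Ω] [MeasurableSpace 𝓧] {P : Measure Ω}
    {X : ι → κ → Ω → 𝓧} (mX : ∀ i j, Measurable (X i j))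
    (h : iIndepFun (fun p : ι × κ => X p.1 p.2) P) :
    iIndepFun (fun i ω j => X i j ω) P := by
  have := h.isProbabilityMeasure
  have : ∀ i j, IsProbabilityMeasure (P.map (X i j)) :=
    fun i j => Measure.isProbabilityMeasure_map (mX i j).aemeasurable
  have hi : ∀ i, P.map (fun ω j => X i j ω) = Measure.infinitePi fun j => P.map (X i j) := fun i =>
    (iIndepFun_iff_map_fun_eq_infinitePi_map (mX i)).1
      (h.precomp (g := fun j => (i, j)) (Prod.mk_right_injective i))
  have hs : iIndepFun (fun p : (_ : ι) × κ => X p.1 p.2) P :=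
    h.precomp (Equiv.sigmaEquivProd ι κ).injective
  have hs' := (iIndepFun_iff_map_fun_eq_infinitePi_map
    fun p : (_ : ι) × κ => mX p.1 p.2).1 hs
  rw [iIndepFun_iff_map_fun_eq_infinitePi_map (by fun_prop)]
  simp_rw [hi]
  -- Currying turns the product law of the whole array into the product of the laws of its rows.
  rw [← Measure.infinitePi_map_piCurry (fun i j => P.map (X i j)), ← hs',
    Measure.map_map (by fun_prop) (by fun_prop)]
  congr 1

theorem isMBest_iff {K M : ℕ} {x : ℕ → ℝ} (k : Fin K) :
    IsMBest K M x k ↔ k ∈ bestSet M fun i : Fin K => x i := by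
  have : #{j ∈ range K | x k < x j} = #{j : Fin K | x k < x j} := by
    symm
    refine card_bij (fun j _ => (j : ℕ)) (by simp) (by simp [Fin.ext_iff]) fun j hj => ?_
    rw [mem_filter, mem_range] at hj
    exact ⟨⟨j, hj.1⟩, by simpa using hj.2, rfl⟩
  rw [mem_bestSet, IsMBest, this]
  simp

/-- Hall's theorem for perfect matching allocations. -/
theorem exists_isPMAllocation {b N M : ℕ} {x : ℕ → ℕ → ℝ}
    (h : ∀ S ⊆ range N, b * #S ≤ #(S.biUnion fun n => bestSet M fun k : Fin (b * N) => x n k)) :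
    ∃ B, IsPMAllocation b N M x B := by
  classical
  -- Each user is replaced by `b` copies with the same best set, each to be matched with one
  -- channel.
  obtain ⟨f, hf, hfm⟩ := (all_card_le_biUnion_card_iff_exists_injective
    (fun p : Fin N × Fin b => bestSet M fun k : Fin (b * N) => x p.1 k)).1 fun s => by
      set S : Finset ℕ := s.image fun p => (p.1 : ℕ)
      have h1 : #s ≤ b * #S := by
        have hc : #(S ×ˢ (univ : Finset (Fin b))) = b * #S := by simp [card_product, mul_comm]
        rw [← hc]
        refine card_le_card_of_injOn (fun p => ((p.1 : ℕ), p.2)) (fun p hp => ?_) ?_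
        · exact mem_coe.2 (mem_product.2 ⟨mem_image_of_mem _ hp, mem_univ _⟩)
        · rintro ⟨p, i⟩ - ⟨q, j⟩ - hpq
          simpa [Fin.ext_iff] using hpq
      refine h1.trans ((h S fun n hn => ?_).trans (card_le_card fun k hk => ?_))
      · obtain ⟨p, -, rfl⟩ := mem_image.1 hn
        simp
      · simpa [S] using hk
  have hinj : Function.Injective fun p : Fin N × Fin b => (f p : ℕ) :=
    Fin.val_injective.comp hf
  refine ⟨fun n => if hn : n < N then univ.image fun i : Fin b => (f (⟨n, hn⟩, i) : ℕ) else ∅,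
    fun n hn => ?_, fun n hn k hk => ?_, fun m hm n hn hmn => ?_⟩
  · simp only [hn, dite_true]
    rw [card_image_of_injective _ fun i j hij => (Prod.ext_iff.1 (hinj hij)).2]
    simp
  · simp only [hn, dite_true, mem_image, mem_univ, true_and] at hk
    obtain ⟨i, rfl⟩ := hk
    exact (isMBest_iff _).2 (hfm (⟨n, hn⟩, i))
  · simp only [hm, hn, dite_true]
    rw [disjoint_left]
    intro k hk hk'
    simp only [mem_image, mem_univ, true_and] at hk hk'
    obtain ⟨i, rfl⟩ := hk
    obtain ⟨j, hj⟩ := hk'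
    exact hmn (Fin.ext_iff.1 (Prod.ext_iff.1 (hinj hj)).1).symm

/-- The union of best sets violating Hall's condition is padded to exactly `b * s - 1` channels, so
that the terms of the union bound depend on `s` alone. -/
theorem exists_subset_of_not_exists_isPMAllocation {b N M : ℕ} {x : ℕ → ℕ → ℝ}
    (h : ¬∃ B, IsPMAllocation b N M x B) :
    ∃ s ∈ Icc 1 N, ∃ S ∈ powersetCard s (range N),
      ∃ T ∈ powersetCard (b * s - 1) (univ : Finset (Fin (b * N))),
        ∀ n ∈ S, (bestSet M fun k : Fin (b * N) => x n k) ⊆ T := by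
  classical
  obtain ⟨S, hSN, hS⟩ : ∃ S ⊆ range N,
      #(S.biUnion fun n => bestSet M fun k : Fin (b * N) => x n k) < b * #S := by
    by_contra! H
    exact h (exists_isPMAllocation H)
  have hcard : #S ≤ N := by simpa using card_le_card hSN
  have hpos : 0 < #S := Nat.pos_of_ne_zero fun h0 => by simp [h0] at hS
  have hle : b * #S ≤ b * N := Nat.mul_le_mul_left _ hcard
  obtain ⟨T, hT, hTc⟩ := exists_superset_card_eq (n := b * #S - 1) (Nat.le_sub_one_of_lt hS)
    (by rw [Fintype.card_fin]; omega)
  exact ⟨#S, mem_Icc.2 ⟨hpos, hcard⟩, S, mem_powersetCard.2 ⟨hSN, rfl⟩, T,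
    mem_powersetCard.2 ⟨subset_univ _, hTc⟩, fun n hn =>
      (subset_biUnion_of_mem (fun n => bestSet M fun k : Fin (b * N) => x n k) hn).trans hT⟩

/-! ### The union bound over violations of Hall's condition -/

section Gains

variable {Ω : Type*} [MeasurableSpace Ω] {μ : Measure Ω} {g : ℕ → ℕ → Ω → ℝ}

theorem map_gains_eq_pi (hmeas : ∀ n k, Measurable (g n k))
    (hindep : iIndepFun (fun p : ℕ × ℕ => g p.1 p.2) μ)
    (hident : ∀ n k l, IdentDistrib (g n k) (g n l) μ μ) (n K : ℕ) :
    μ.map (fun ω (k : Fin K) => g n k ω) = Measure.pi fun _ => μ.map (g n 0) := by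
  have := hindep.isProbabilityMeasure
  have h : iIndepFun (fun k : Fin K => g n k) μ :=
    hindep.precomp (g := fun k : Fin K => (n, (k : ℕ)))
      ((Prod.mk_right_injective n).comp Fin.val_injective)
  rw [(iIndepFun_iff_map_fun_eq_pi_map fun k : Fin K => (hmeas n k).aemeasurable).1 h]
  congr 1
  ext1 k
  exact (hident n k 0).map_eq

theorem measureReal_iInter_bestSet_subset_le (hmeas : ∀ n k, Measurable (g n k))
    (hindep : iIndepFun (fun p : ℕ × ℕ => g p.1 p.2) μ)
    (hident : ∀ n k l, IdentDistrib (g n k) (g n l) μ μ) {K M : ℕ} (hM : M ≤ K)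
    (S : Finset ℕ) (T : Finset (Fin K)) :
    μ.real (⋂ n ∈ S, {ω | (bestSet M fun k : Fin K => g n k ω) ⊆ T}) ≤
      ((#T : ℝ) / K) ^ (M * #S) := by
  have := hindep.isProbabilityMeasure
  have hcomp : iIndepFun (fun n ω (k : Fin K) => g n k ω) μ :=
    (iIndepFun_curry hmeas hindep).comp (fun _ x (k : Fin K) => x k) fun _ => by fun_prop
  have hmT := measurableSet_bestSet_subset M T
  have := hcomp.measure_inter_preimage_eq_mul S (sets := fun _ => {x | bestSet M x ⊆ T})
    fun _ _ => hmT
  rw [measureReal_def]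
  simp only [Set.preimage_ofPred_eq] at this
  rw [this, ENNReal.toReal_prod, pow_mul, ← prod_const]
  refine prod_le_prod (fun _ _ => ENNReal.toReal_nonneg) fun n _ => ?_
  have : IsProbabilityMeasure (μ.map (g n 0)) :=
    Measure.isProbabilityMeasure_map (hmeas n 0).aemeasurable
  have h := measureReal_bestSet_subset_le (μ.map (g n 0))
    (by simpa using hM : M ≤ Fintype.card (Fin K)) T
  rw [← map_gains_eq_pi hmeas hindep hident, map_measureReal_apply (by fun_prop) hmT,
    Fintype.card_fin] at h
  exact h

theorem measureReal_not_exists_isPMAllocation_le (hmeas : ∀ n k, Measurable (g n k))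
    (hindep : iIndepFun (fun p : ℕ × ℕ => g p.1 p.2) μ)
    (hident : ∀ n k l, IdentDistrib (g n k) (g n l) μ μ) {b N M : ℕ} (hM : M ≤ b * N) :
    μ.real {ω | ¬∃ B, IsPMAllocation b N M (fun n k => g n k ω) B} ≤
      ∑ s ∈ Icc 1 N, (N.choose s : ℝ) * ((b * N).choose (b * s - 1) : ℝ) *
        (((b * s - 1 : ℕ) : ℝ) / (b * N : ℕ)) ^ (M * s) := by
  have := hindep.isProbabilityMeasure
  have hsub : {ω | ¬∃ B, IsPMAllocation b N M (fun n k => g n k ω) B} ⊆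
      ⋃ s ∈ Icc 1 N, ⋃ S ∈ powersetCard s (range N),
        ⋃ T ∈ powersetCard (b * s - 1) (univ : Finset (Fin (b * N))),
          ⋂ n ∈ S, {ω | (bestSet M fun k : Fin (b * N) => g n k ω) ⊆ T} := fun ω hω => by
    obtain ⟨s, hs, S, hS, T, hT, h⟩ := exists_subset_of_not_exists_isPMAllocation hω
    simp only [Set.mem_iUnion, Set.mem_iInter]
    exact ⟨s, hs, S, hS, T, hT, h⟩
  refine (measureReal_mono hsub (measure_ne_top _ _)).trans ((measureReal_biUnion_finset_le _ _).trans
    (sum_le_sum fun s _ => ?_))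
  refine (measureReal_biUnion_finset_le _ _).trans ((sum_le_card_nsmul _ _
    ((b * N).choose (b * s - 1) * (((b * s - 1 : ℕ) : ℝ) / (b * N : ℕ)) ^ (M * s))
      fun S hS => ?_).trans_eq ?_)
  · refine (measureReal_biUnion_finset_le _ _).trans ((sum_le_card_nsmul _ _
      ((((b * s - 1 : ℕ) : ℝ) / (b * N : ℕ)) ^ (M * s)) fun T hT => ?_).trans_eq ?_)
    · have := measureReal_iInter_bestSet_subset_le hmeas hindep hident hM S T
      rwa [(mem_powersetCard.1 hT).2, (mem_powersetCard.1 hS).2] at this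
    · rw [card_powersetCard, card_univ, Fintype.card_fin, nsmul_eq_mul]
  · rw [card_powersetCard, card_range, nsmul_eq_mul, mul_assoc]

end Gains

/-! ### Estimates of the union bound -/

theorem choose_mul_div_pow_le_exp (n k : ℕ) :
    (n.choose k : ℝ) * ((k : ℝ) / n) ^ k ≤ Real.exp k := by
  rcases Nat.eq_zero_or_pos n with rfl | hn
  · rcases Nat.eq_zero_or_pos k with rfl | hk
    · simp
    · simp [hk.ne', Real.exp_nonneg]
  have hn' : (0 : ℝ) < n := by exact_mod_cast hn
  calc (n.choose k : ℝ) * ((k : ℝ) / n) ^ k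
      ≤ (n : ℝ) ^ k / k.factorial * ((k : ℝ) / n) ^ k := by
        gcongr
        exact Nat.choose_le_pow_div k n
    _ = (k : ℝ) ^ k / k.factorial := by
        rw [div_pow]
        field_simp
    _ ≤ Real.exp k := Real.pow_div_factorial_le_exp _ (by positivity) k

/-- For few users, `t + s ≤ (b + 1) * s` of the `M * s` factors `u` pay for the two binomials, by
`choose_mul_div_pow_le_exp`. The remaining ones are at most `c` each. -/
theorem unionBound_term_le_of_le {b N M s : ℕ} {c : ℝ} (hb : 0 < b) (hs : 0 < s) (hsN : s ≤ N)
    (hM : b + 1 ≤ M) (hc : (s : ℝ) / N ≤ c) (hc1 : c ≤ 1) :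
    (N.choose s : ℝ) * ((b * N).choose (b * s - 1) : ℝ) *
        (((b * s - 1 : ℕ) : ℝ) / (b * N : ℕ)) ^ (M * s) ≤
      (Real.exp (b + 1) * c ^ (M - (b + 1))) ^ s := by
  set t := b * s - 1 with ht
  have hbs : 0 < b * s := Nat.mul_pos hb hs
  have hN : (0 : ℝ) < N := by exact_mod_cast hs.trans_le hsN
  have hb' : (0 : ℝ) < b := by exact_mod_cast hb
  set u : ℝ := (t : ℝ) / (b * N : ℕ) with hu
  have hu0 : 0 ≤ u := by positivity
  have hts : (t : ℝ) ≤ b * s := by exact_mod_cast Nat.sub_le _ _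
  have hus : u ≤ (s : ℝ) / N := by
    rw [hu, Nat.cast_mul, div_le_div_iff₀ (by positivity) hN]
    nlinarith
  have hu1 : u ≤ 1 := hus.trans (hc.trans hc1)
  have hexp : t + s + (M - (b + 1)) * s ≤ M * s := by
    obtain ⟨d, rfl⟩ := Nat.exists_eq_add_of_le hM
    have : b + 1 + d - (b + 1) = d := by omega
    rw [this, add_mul, add_mul]
    omega
  calc (N.choose s : ℝ) * ((b * N).choose t : ℝ) * u ^ (M * s)
      ≤ (N.choose s : ℝ) * ((b * N).choose t : ℝ) * u ^ (t + s + (M - (b + 1)) * s) := by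
        gcongr ?_ * ?_
        exact pow_le_pow_of_le_one hu0 hu1 hexp
    _ = ((N.choose s : ℝ) * u ^ s) * (((b * N).choose t : ℝ) * u ^ t) *
          (u ^ (M - (b + 1))) ^ s := by
        rw [pow_add, pow_add, pow_mul]
        ring
    _ ≤ Real.exp s * Real.exp (b * s) * (c ^ (M - (b + 1))) ^ s := by
        gcongr
        · refine le_trans ?_ (choose_mul_div_pow_le_exp N s)
          gcongr
        · exact (choose_mul_div_pow_le_exp (b * N) t).trans (Real.exp_le_exp.2 hts)
        · exact hus.trans hc
    _ = (Real.exp (b + 1) * c ^ (M - (b + 1))) ^ s := by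
        rw [mul_pow, ← Real.exp_nat_mul, ← Real.exp_add]
        ring_nf

/-- For nearly all users, with `r = N - s` left out, the binomials are at most `K ^ ((b + 1) * r +
1)`, and `1 - y ≤ exp (-y)` bounds the power. The factor `b + 1` in `M` balances the two. The
constant `c` gives up half of the margin `ε`, and the other half remains as decay. -/
theorem unionBound_term_le_of_ge {b N M s : ℕ} {ε c : ℝ} (hb : 0 < b) (hε : 0 < ε) (hs : 0 < s)
    (hsN : s ≤ N) (hM : ((b : ℝ) + 1) * (1 + ε) * Real.log ((b * N : ℕ) : ℝ) ≤ M)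
    (hc : c ≤ (s : ℝ) / N) (hc0 : 0 ≤ c) (hcε : c * (1 + ε) = 1 + ε / 2) :
    (N.choose s : ℝ) * ((b * N).choose (b * s - 1) : ℝ) *
        (((b * s - 1 : ℕ) : ℝ) / (b * N : ℕ)) ^ (M * s) ≤
      (((b * N : ℕ) : ℝ) ^ (-(ε / 2))) ^ (N - s + 1) := by
  obtain ⟨r, rfl⟩ := Nat.exists_eq_add_of_le hsN
  have hbs : 0 < b * s := Nat.mul_pos hb hs
  set K := b * (s + r) with hK
  -- The `+ 1` is what leaves some decay when `r = 0`, where `T` misses a single channel.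
  have hKt : K = (b * s - 1) + (b * r + 1) := by rw [hK, mul_add]; omega
  have hNK : s + r ≤ K := Nat.le_mul_of_pos_left _ hb
  have hK0 : (0 : ℝ) < K := by exact_mod_cast (show 0 < K by omega)
  have hb' : (1 : ℝ) ≤ b := by exact_mod_cast hb
  have hN : (0 : ℝ) < ((s + r : ℕ) : ℝ) := by exact_mod_cast (show 0 < s + r by omega)
  set l := Real.log (K : ℝ) with hl
  have hl0 : 0 ≤ l := Real.log_natCast_nonneg K
  have hKe : (K : ℝ) = Real.exp l := (Real.exp_log hK0).symm
  have h1 : ((s + r).choose s : ℝ) ≤ (K : ℝ) ^ r := by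
    have : (s + r).choose s ≤ K ^ r := by
      rw [Nat.choose_symm_add]
      exact (Nat.choose_le_pow _ _).trans (Nat.pow_le_pow_left hNK r)
    exact_mod_cast this
  have h2 : (K.choose (b * s - 1) : ℝ) ≤ (K : ℝ) ^ (b * r + 1) := by
    have : K.choose (b * s - 1) ≤ K ^ (b * r + 1) := by
      have := Nat.choose_symm_of_eq_add hKt
      rw [this]
      exact Nat.choose_le_pow _ _
    exact_mod_cast this
  have h3 : ((b * s - 1 : ℕ) : ℝ) / K ≤ Real.exp (-((b * r + 1) / K)) := by
    have hcast : (K : ℝ) = ((b * s - 1 : ℕ) : ℝ) + (b * r + 1) := by exact_mod_cast hKt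
    have : ((b * s - 1 : ℕ) : ℝ) / K = -((b * r + 1) / K) + 1 := by
      rw [eq_sub_of_add_eq hcast.symm]
      field_simp
      ring
    rw [this]
    exact Real.add_one_le_exp _
  have h4 : ((b : ℝ) + 1) * (1 + ε / 2) * l ≤ M * (s / (s + r : ℕ)) := by
    calc ((b : ℝ) + 1) * (1 + ε / 2) * l = ((b : ℝ) + 1) * (1 + ε) * l * c := by
          rw [← hcε]; ring
      _ ≤ M * (s / (s + r : ℕ)) := by gcongr
  have h5 : (1 + ε / 2) * ((b + 1) * r + 1) * l ≤ (b * r + 1) / K * (M * s) := by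
    have hKc : (K : ℝ) = b * (s + r : ℕ) := by rw [hK]; push_cast; ring
    have : ((b * r + 1 : ℝ) / K) * (M * s) = (b * r + 1) / b * (M * (s / (s + r : ℕ))) := by
      rw [hKc]; field_simp
    rw [this]
    calc (1 + ε / 2) * ((b + 1) * r + 1) * l
        ≤ (1 + ε / 2) * ((b * r + 1) / b * (b + 1)) * l := by
          gcongr
          rw [div_mul_eq_mul_div, le_div_iff₀ (by positivity)]
          nlinarith
      _ = (b * r + 1) / b * ((b + 1) * (1 + ε / 2) * l) := by ring
      _ ≤ _ := by gcongr
  calc ((s + r).choose s : ℝ) * (K.choose (b * s - 1) : ℝ) *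
        (((b * s - 1 : ℕ) : ℝ) / K) ^ (M * s)
      ≤ (K : ℝ) ^ r * (K : ℝ) ^ (b * r + 1) * Real.exp (-((b * r + 1) / K)) ^ (M * s) := by
        gcongr
    _ = Real.exp (((b + 1) * r + 1) * l - (b * r + 1) / K * (M * s)) := by
        rw [← pow_add]
        nth_rewrite 1 [hKe]
        rw [← Real.exp_nat_mul, ← Real.exp_nat_mul, ← Real.exp_add]
        congr 1
        push_cast
        ring
    _ ≤ Real.exp (-(ε / 2) * (r + 1) * l) := by
        refine Real.exp_le_exp.2 ?_
        have : (ε / 2) * (r + 1) * l ≤ (ε / 2) * ((b + 1) * r + 1) * l := by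
          gcongr
          nlinarith [(Nat.cast_nonneg r : (0 : ℝ) ≤ r)]
        nlinarith
    _ = ((K : ℝ) ^ (-(ε / 2))) ^ (s + r - s + 1) := by
        rw [Nat.add_sub_cancel_left, Real.rpow_def_of_pos hK0, ← Real.exp_nat_mul]
        congr 1
        push_cast
        ring

theorem sum_pow_succ_le {p : ℝ} (hp : 0 ≤ p) (hp2 : p ≤ 1 / 2) (N : ℕ) :
    ∑ i ∈ range N, p ^ (i + 1) ≤ 2 * p := by
  calc ∑ i ∈ range N, p ^ (i + 1) ≤ ∑ i ∈ range N, (1 / 2) ^ i * p := by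
        refine sum_le_sum fun i _ => ?_
        rw [pow_succ]
        gcongr
    _ = (∑ i ∈ range N, (1 / 2 : ℝ) ^ i) * p := by rw [sum_mul]
    _ ≤ 2 * p := by
        gcongr
        exact sum_geometric_two_le N

theorem unionBound_le {b N M : ℕ} {ε c : ℝ} (hb : 0 < b) (hε : 0 < ε) (hMb : b + 1 ≤ M)
    (hM : ((b : ℝ) + 1) * (1 + ε) * Real.log ((b * N : ℕ) : ℝ) ≤ M)
    (hc0 : 0 ≤ c) (hc1 : c ≤ 1) (hcε : c * (1 + ε) = 1 + ε / 2)
    (hp : Real.exp (b + 1) * c ^ (M - (b + 1)) ≤ 1 / 2)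
    (hq : ((b * N : ℕ) : ℝ) ^ (-(ε / 2)) ≤ 1 / 2) :
    ∑ s ∈ Icc 1 N, (N.choose s : ℝ) * ((b * N).choose (b * s - 1) : ℝ) *
        (((b * s - 1 : ℕ) : ℝ) / (b * N : ℕ)) ^ (M * s) ≤
      2 * (Real.exp (b + 1) * c ^ (M - (b + 1))) + 2 * ((b * N : ℕ) : ℝ) ^ (-(ε / 2)) := by
  set p := Real.exp (b + 1) * c ^ (M - (b + 1))
  set q := ((b * N : ℕ) : ℝ) ^ (-(ε / 2))
  have hp0 : 0 ≤ p := by positivity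
  have hq0 : 0 ≤ q := by positivity
  calc _ ≤ ∑ s ∈ Icc 1 N, (p ^ s + q ^ (N - s + 1)) := by
        refine sum_le_sum fun s hs => ?_
        obtain ⟨hs1, hsN⟩ := mem_Icc.1 hs
        rcases le_total ((s : ℝ) / N) c with h | h
        · exact (unionBound_term_le_of_le hb hs1 hsN hMb h hc1).trans
            (le_add_of_nonneg_right (by positivity))
        · exact (unionBound_term_le_of_ge hb hε hs1 hsN hM h hc0 hcε).trans
            (le_add_of_nonneg_left (by positivity))
    _ = ∑ i ∈ range N, p ^ (i + 1) + ∑ i ∈ range N, q ^ (i + 1) := by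
        -- Reversing the second sum makes both geometric series start at the first power, so each is
        -- at most twice its ratio.
        rw [sum_add_distrib, ← sum_range_reflect (fun i => q ^ (i + 1))]
        have : Icc 1 N = (range N).image (· + 1) := by
          ext x
          simp only [mem_Icc, mem_image, mem_range]
          exact ⟨fun h => ⟨x - 1, by omega, by omega⟩, by rintro ⟨a, ha, rfl⟩; omega⟩
        rw [this, sum_image (by simp), sum_image (by simp)]
        congr 1
        refine sum_congr rfl fun i hi => ?_
        have := mem_range.1 hi
        congr 1
        omega
    _ ≤ 2 * p + 2 * q := add_le_add (sum_pow_succ_le hp0 hp _) (sum_pow_succ_le hq0 hq _)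

theorem tendsto_natCast_mul_atTop {b : ℕ} (hb : 0 < b) :
    Tendsto (fun N : ℕ => ((b * N : ℕ) : ℝ)) atTop atTop :=
  tendsto_natCast_atTop_atTop.comp (tendsto_id.const_mul_atTop' hb)

theorem tendsto_feedbackSize {b : ℕ} {ε : ℝ} (hb : 0 < b) (hε : 0 < ε) :
    Tendsto (feedbackSize b ε) atTop atTop :=
  tendsto_nat_ceil_atTop.comp
    ((Real.tendsto_log_atTop.comp (tendsto_natCast_mul_atTop hb)).const_mul_atTop (by positivity))

theorem eventually_feedbackSize_le {b : ℕ} {ε : ℝ} (hb : 0 < b) (hε : 0 < ε) :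
    ∀ᶠ N in atTop, feedbackSize b ε N ≤ b * N := by
  set a := ((b : ℝ) + 1) * (1 + ε)
  have ha : 0 < a := by positivity
  have h := (Real.isLittleO_log_id_atTop.bound (inv_pos.2 ha))
  filter_upwards [(tendsto_natCast_mul_atTop hb).eventually h] with N hN
  refine Nat.ceil_le.2 ?_
  have := (le_abs_self _).trans hN
  simp only [id, Real.norm_eq_abs, Nat.abs_cast] at this
  rwa [← div_eq_inv_mul, le_div_iff₀' ha] at this

theorem tendsto_measureReal_not_exists_isPMAllocation {Ω : Type*} [MeasurableSpace Ω]
    {μ : Measure Ω} {g : ℕ → ℕ → Ω → ℝ} (hmeas : ∀ n k, Measurable (g n k))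
    (hindep : iIndepFun (fun p : ℕ × ℕ => g p.1 p.2) μ)
    (hident : ∀ n k l, IdentDistrib (g n k) (g n l) μ μ) {b : ℕ} (hb : 0 < b) {ε : ℝ}
    (hε : 0 < ε) :
    Tendsto (fun N => μ.real {ω | ¬∃ B,
      IsPMAllocation b N (feedbackSize b ε N) (fun n k => g n k ω) B}) atTop (𝓝 0) := by
  obtain ⟨c, hc0, hc1, hcε⟩ : ∃ c : ℝ, 0 ≤ c ∧ c < 1 ∧ c * (1 + ε) = 1 + ε / 2 :=
    ⟨(1 + ε / 2) / (1 + ε), by positivity, by rw [div_lt_one (by positivity)]; linarith,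
      by field_simp⟩
  have hM := tendsto_feedbackSize hb hε
  have hp : Tendsto (fun N => Real.exp (b + 1) * c ^ (feedbackSize b ε N - (b + 1)))
      atTop (𝓝 0) := by
    simpa using ((tendsto_pow_atTop_nhds_zero_of_lt_one hc0 hc1).comp
      ((tendsto_sub_atTop_nat (b + 1)).comp hM)).const_mul (Real.exp (b + 1))
  have hq : Tendsto (fun N : ℕ => ((b * N : ℕ) : ℝ) ^ (-(ε / 2))) atTop (𝓝 0) :=
    (tendsto_rpow_neg_atTop (half_pos hε)).comp (tendsto_natCast_mul_atTop hb)
  refine squeeze_zero' (.of_forall fun _ => measureReal_nonneg) ?_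
    (by simpa only [mul_zero, add_zero] using (hp.const_mul 2).add (hq.const_mul 2))
  filter_upwards [hM.eventually_ge_atTop (b + 1), eventually_feedbackSize_le hb hε,
    hp.eventually_le_const (by norm_num : (0 : ℝ) < 1 / 2),
    hq.eventually_le_const (by norm_num : (0 : ℝ) < 1 / 2)] with N h1 h2 h3 h4
  exact (measureReal_not_exists_isPMAllocation_le hmeas hindep hident h2).trans
    (unionBound_le hb hε h1 (Nat.le_ceil _) hc0 hc1.le hcε h3 h4)

/-! ### From large gains to close rates -/

theorem HasExpDominatedTail.measureReal_Ioi_pos {ν : Measure ℝ} [IsProbabilityMeasure ν]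
    (h : HasExpDominatedTail ν) (L : ℝ) : 0 < ν.real (Set.Ioi L) := by
  obtain ⟨-, α, β, lam, γ, -, -, -, h⟩ := h
  obtain ⟨x, hx, hLx⟩ := ((h.eventually_ne one_ne_zero).and (eventually_ge_atTop L)).exists
  -- Were the tail zero at `x`, the quotient would be zero there, but it is close to `1`.
  have h1 : 1 - cdf ν x ≠ 0 := fun h0 => hx (by rw [h0, zero_div])
  have h2 : 0 < 1 - cdf ν x := lt_of_le_of_ne (sub_nonneg.2 (cdf_le_one ν x)) h1.symm
  rw [← Set.compl_Iic, probReal_compl_eq_one_sub measurableSet_Iic, ← cdf_eq_real]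
  linarith [monotone_cdf ν hLx]

theorem IsMBest.lt_of_le_card {K M : ℕ} {x : ℕ → ℝ} {k : ℕ} (hk : IsMBest K M x k) {L : ℝ}
    (h : M ≤ #{j ∈ range K | L < x j}) : L < x k := by
  by_contra! hL
  refine absurd (h.trans (card_le_card fun j hj => ?_)) hk.2.not_ge
  rw [mem_filter] at hj ⊢
  exact ⟨hj.1, hL.trans_lt hj.2⟩

theorem equalPowerRate_le_waterFillingRate {b : ℕ} {Pmax N₀ : ℝ} (hb : 0 < b) (hP : 0 ≤ Pmax)
    (hN₀ : 0 < N₀) (x : ℕ → ℝ) {A : Finset ℕ} (hA : #A = b) :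
    equalPowerRate b Pmax N₀ x A ≤ waterFillingRate Pmax N₀ x A := by
  refine (isGreatest_waterFillingRate hP hN₀ x A).2 ⟨_, ⟨fun k _ => by positivity, ?_⟩, rfl⟩
  have : (b : ℝ) ≠ 0 := by positivity
  rw [sum_const, hA, nsmul_eq_mul, mul_div_cancel₀ _ this]

/-- Water-filling gains at most the factor `b` in power in each of the `b` channels. -/
theorem waterFillingRate_le {b : ℕ} {Pmax N₀ : ℝ} (hb : 0 < b) (hP : 0 ≤ Pmax)
    (hN₀ : 0 < N₀) (x : ℕ → ℝ) {A : Finset ℕ} (hA : #A = b) :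
    waterFillingRate Pmax N₀ x A ≤ equalPowerRate b Pmax N₀ x A + b * Real.logb 2 b := by
  obtain ⟨P, ⟨hP0, hPs⟩, hPr⟩ := (isGreatest_waterFillingRate hP hN₀ x A).1
  have hb' : (1 : ℝ) ≤ b := by exact_mod_cast hb
  rw [← hPr, equalPowerRate, rate, rate, ← hA, ← nsmul_eq_mul, ← sum_const, ← sum_add_distrib, hA]
  refine sum_le_sum fun k hk => ?_
  have hPk : P k ≤ Pmax := (single_le_sum hP0 hk).trans hPs
  have hPk0 := hP0 k hk
  rw [← Real.logb_mul (by positivity) (by positivity)]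
  refine Real.logb_le_logb_of_le (by norm_num) (by positivity) ?_
  calc 1 + x k ^ 2 * P k / N₀ ≤ b + x k ^ 2 * Pmax / N₀ := by gcongr
    _ = (1 + x k ^ 2 * (Pmax / b) / N₀) * b := by field_simp

theorem le_equalPowerRate {b : ℕ} {Pmax N₀ L : ℝ} (hP : 0 ≤ Pmax)
    (hN₀ : 0 < N₀) (hL : 0 ≤ L) {x : ℕ → ℝ} {A : Finset ℕ} (hA : #A = b)
    (hx : ∀ k ∈ A, L ≤ x k) :
    b * Real.logb 2 (1 + L ^ 2 * (Pmax / b) / N₀) ≤ equalPowerRate b Pmax N₀ x A := by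
  rw [equalPowerRate, rate]
  conv_lhs => rw [← hA]
  rw [← nsmul_eq_mul]
  refine card_nsmul_le_sum _ _ _ fun k hk => ?_
  have := hx k hk
  rw [hA]
  exact Real.logb_le_logb_of_le (by norm_num) (by positivity) (by gcongr)

theorem exists_rate_threshold {b : ℕ} {Pmax N₀ δ : ℝ} (hb : 0 < b) (hP : 0 < Pmax)
    (hN₀ : 0 < N₀) (hδ : 0 < δ) :
    ∃ L : ℝ, ∀ (x : ℕ → ℝ) (A : Finset ℕ), #A = b → (∀ k ∈ A, L < x k) →
      0 < equalPowerRate b Pmax N₀ x A ∧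
      equalPowerRate b Pmax N₀ x A ≤ waterFillingRate Pmax N₀ x A ∧
      waterFillingRate Pmax N₀ x A < (1 + δ) * equalPowerRate b Pmax N₀ x A := by
  have hb' : (0 : ℝ) < b := by exact_mod_cast hb
  have h : Tendsto (fun L : ℝ => Real.logb 2 (1 + L ^ 2 * (Pmax / b) / N₀)) atTop atTop := by
    refine (Real.tendsto_logb_atTop (by norm_num)).comp (tendsto_atTop_add_const_left _ _ ?_)
    exact ((tendsto_pow_atTop two_ne_zero).atTop_mul_const (by positivity)).atTop_div_const hN₀
  -- Beyond this `L` each channel carries more than `logb 2 b / δ` bits, so the excess `b * logb 2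
  -- b` is below `δ` times the equal-power rate.
  obtain ⟨L, ⟨h1, h2⟩, h3⟩ := ((h.eventually_gt_atTop 0).and
    (h.eventually_gt_atTop (Real.logb 2 b / δ)) |>.and (eventually_ge_atTop 0)).exists
  refine ⟨L, fun x A hA hx => ?_⟩
  have hle := le_equalPowerRate hP.le hN₀ h3 hA fun k hk => (hx k hk).le
  refine ⟨(mul_pos hb' h1).trans_le hle, equalPowerRate_le_waterFillingRate hb hP.le hN₀ x hA,
    (waterFillingRate_le hb hP.le hN₀ x hA).trans_lt ?_⟩
  rw [div_lt_iff₀ hδ] at h2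
  nlinarith

/-! ### Every user has enough large gains -/

section Tail

variable {Ω : Type*} [MeasurableSpace Ω] {μ : Measure Ω} {g : ℕ → ℕ → Ω → ℝ}

/-- Markov's inequality for `(1 / 2) ^ X`, where `X` counts the gains above `L`. By independence its
mean is `(1 - q / 2) ^ K`. -/
theorem measureReal_card_lt_le (hmeas : ∀ n k, Measurable (g n k))
    (hindep : iIndepFun (fun p : ℕ × ℕ => g p.1 p.2) μ)
    (hident : ∀ n k l, IdentDistrib (g n k) (g n l) μ μ) (n K M : ℕ) (L : ℝ) :
    μ.real {ω | #{k ∈ range K | L < g n k ω} < M} ≤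
      2 ^ M * (1 - (μ.map (g n 0)).real (Set.Ioi L) / 2) ^ K := by
  have := hindep.isProbabilityMeasure
  have : ∀ k, IsProbabilityMeasure (μ.map (g n k)) := fun k =>
    Measure.isProbabilityMeasure_map (hmeas n k).aemeasurable
  set q := (μ.map (g n 0)).real (Set.Ioi L)
  have hind : iIndepFun (fun k : Fin K => g n k) μ :=
    hindep.precomp (g := fun k : Fin K => (n, (k : ℕ)))
      ((Prod.mk_right_injective n).comp Fin.val_injective)
  set h : ℝ → ℝ := fun y => 1 - (Set.Ioi L).indicator (fun _ => (1 / 2 : ℝ)) y with hh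
  have hm : Measurable h := by
    exact measurable_const.sub (measurable_const.indicator measurableSet_Ioi)
  have hint : ∀ k : Fin K, ∫ ω, h (g n k ω) ∂μ = 1 - q / 2 := fun k => by
    rw [← integral_map (hmeas n k).aemeasurable hm.aestronglyMeasurable, (hident n k 0).map_eq, hh,
      integral_sub (integrable_const _) ((integrable_const _).indicator measurableSet_Ioi),
      integral_indicator_const _ measurableSet_Ioi]
    simp [q, div_eq_mul_inv]
  have hprod := hind.integral_fun_prod_comp (f := fun _ => h)
    (fun k => (hmeas n k).aemeasurable) fun _ => hm.aestronglyMeasurable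
  simp only [hint, prod_const, card_univ, Fintype.card_fin] at hprod
  have heq : ∀ ω, ∏ k : Fin K, h (g n k ω) = (1 / 2 : ℝ) ^ #{k ∈ range K | L < g n k ω} :=
    fun ω => by
      rw [Fin.prod_univ_eq_prod_range (fun k => h (g n k ω)) K, ← prod_const, prod_filter]
      refine prod_congr rfl fun k _ => ?_
      by_cases hk : L < g n k ω
      · simp [hh, Set.indicator_apply, hk]
        norm_num
      · simp [hh, Set.indicator_apply, hk]
  simp only [heq] at hprod
  have hcm : Measurable fun ω => (1 / 2 : ℝ) ^ #{k ∈ range K | L < g n k ω} := by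
    simp_rw [← heq]
    exact Finset.measurable_prod _ fun k _ => hm.comp (hmeas n k)
  have hci : Integrable (fun ω => (1 / 2 : ℝ) ^ #{k ∈ range K | L < g n k ω}) μ := by
    refine Integrable.of_bound hcm.aestronglyMeasurable 1 (.of_forall fun ω => ?_)
    rw [Real.norm_of_nonneg (by positivity)]
    exact pow_le_one₀ (by norm_num) (by norm_num)
  have hmarkov := mul_meas_ge_le_integral_of_nonneg (.of_forall fun ω => by positivity) hci
    ((1 / 2 : ℝ) ^ M)
  rw [hprod] at hmarkov
  calc μ.real {ω | #{k ∈ range K | L < g n k ω} < M}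
      ≤ μ.real {ω | (1 / 2 : ℝ) ^ M ≤ (1 / 2 : ℝ) ^ #{k ∈ range K | L < g n k ω}} := by
        refine measureReal_mono (fun ω hω => ?_) (measure_ne_top _ _)
        exact pow_le_pow_of_le_one (by norm_num : (0 : ℝ) ≤ 1 / 2) (by norm_num) (le_of_lt hω)
    _ = 2 ^ M * ((1 / 2 : ℝ) ^ M *
          μ.real {ω | (1 / 2 : ℝ) ^ M ≤ (1 / 2 : ℝ) ^ #{k ∈ range K | L < g n k ω}}) := by
        rw [← mul_assoc, ← mul_pow]
        norm_num
    _ ≤ _ := by gcongr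

/-- Since `M` is logarithmic in `K`, `2 ^ M` is polynomial in `K` and loses to the exponential
decay, even after summing over `N` users. -/
theorem tendsto_mul_two_pow_feedbackSize {b : ℕ} {ε q : ℝ} (hb : 0 < b) (hε : 0 < ε) (hq : 0 < q)
    (hq1 : q ≤ 1) :
    Tendsto (fun N : ℕ => (N : ℝ) * (2 ^ feedbackSize b ε N * (1 - q / 2) ^ (b * N)))
      atTop (𝓝 0) := by
  set a := ((b : ℝ) + 1) * (1 + ε)
  have ha : 0 < a := by positivity
  have h := (((tendsto_rpow_mul_exp_neg_mul_atTop_nhds_zero (a + 1) (q / 2) (half_pos hq)).comp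
    (tendsto_natCast_mul_atTop hb)).const_mul (Real.exp 1))
  rw [mul_zero] at h
  have hq2 : 0 ≤ 1 - q / 2 := by linarith
  refine squeeze_zero' (.of_forall fun N => by positivity) ?_ h
  filter_upwards [eventually_gt_atTop 0] with N hN
  set K := b * N
  have hK : (0 : ℝ) < (K : ℕ) := by exact_mod_cast Nat.mul_pos hb hN
  have h1 : (N : ℝ) ≤ K := by exact_mod_cast Nat.le_mul_of_pos_left _ hb
  have h2 : (2 : ℝ) ^ feedbackSize b ε N ≤ Real.exp 1 * (K : ℝ) ^ a := by
    have hM : (feedbackSize b ε N : ℝ) ≤ a * Real.log K + 1 :=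
      (Nat.ceil_lt_add_one (mul_nonneg ha.le (Real.log_natCast_nonneg _))).le
    calc (2 : ℝ) ^ feedbackSize b ε N ≤ Real.exp 1 ^ feedbackSize b ε N := by
          gcongr
          have := Real.add_one_le_exp 1
          linarith
      _ = Real.exp (feedbackSize b ε N) := by rw [← Real.exp_nat_mul, mul_one]
      _ ≤ Real.exp (1 + Real.log K * a) := Real.exp_le_exp.2 (by linarith)
      _ = Real.exp 1 * (K : ℝ) ^ a := by rw [Real.exp_add, Real.rpow_def_of_pos hK]
  have h3 : (1 - q / 2) ^ K ≤ Real.exp (-(q / 2) * K) := by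
    calc (1 - q / 2) ^ K ≤ Real.exp (-(q / 2)) ^ K := by
          gcongr
          linarith [Real.add_one_le_exp (-(q / 2))]
      _ = Real.exp (-(q / 2) * K) := by rw [← Real.exp_nat_mul, mul_comm]
  calc (N : ℝ) * (2 ^ feedbackSize b ε N * (1 - q / 2) ^ K)
      ≤ K * ((Real.exp 1 * (K : ℝ) ^ a) * Real.exp (-(q / 2) * K)) := by gcongr
    _ = Real.exp 1 * ((K : ℝ) ^ (a + 1) * Real.exp (-(q / 2) * K)) := by
        rw [Real.rpow_add_one hK.ne']
        ring

/-- The users in `S N` all have, with probability tending to `1`, water-filling rate and equal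
power rate within a factor `1 + δ` of each other. -/
theorem tendsto_measureReal_not_rates_close (hmeas : ∀ n k, Measurable (g n k))
    (hindep : iIndepFun (fun p : ℕ × ℕ => g p.1 p.2) μ)
    (hident : ∀ n k l, IdentDistrib (g n k) (g n l) μ μ) {b : ℕ} (hb : 0 < b) {ε : ℝ}
    (hε : 0 < ε) {Pmax N₀ : ℝ} (hP : 0 < Pmax) (hN₀ : 0 < N₀) {A : ℕ → Ω → ℕ → Finset ℕ}
    (hA : ∀ N ω,
      (∃ B, IsPMAllocation b N (feedbackSize b ε N) (fun n k => g n k ω) B) →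
        IsPMAllocation b N (feedbackSize b ε N) (fun n k => g n k ω) (A N ω))
    {S : ℕ → Finset ℕ} (hS : ∀ᶠ N in atTop, S N ⊆ range N)
    (htail : ∀ L, ∃ q > 0, ∀ N, ∀ n ∈ S N, q ≤ (μ.map (g n 0)).real (Set.Ioi L))
    {δ : ℝ} (hδ : 0 < δ) :
    Tendsto (fun N => μ.real {ω | ¬∀ n ∈ S N,
      0 < equalPowerRate b Pmax N₀ (fun k => g n k ω) (A N ω n) ∧
      equalPowerRate b Pmax N₀ (fun k => g n k ω) (A N ω n) ≤
        waterFillingRate Pmax N₀ (fun k => g n k ω) (A N ω n) ∧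
      waterFillingRate Pmax N₀ (fun k => g n k ω) (A N ω n) <
        (1 + δ) * equalPowerRate b Pmax N₀ (fun k => g n k ω) (A N ω n)}) atTop (𝓝 0) := by
  have := hindep.isProbabilityMeasure
  obtain ⟨L, hL⟩ := exists_rate_threshold hb hP hN₀ hδ
  obtain ⟨q, hq, hqS⟩ : ∃ q > 0, q ≤ 1 ∧
      ∀ N, ∀ n ∈ S N, q ≤ (μ.map (g n 0)).real (Set.Ioi L) := by
    obtain ⟨q, hq, h⟩ := htail L
    exact ⟨min q 1, by positivity, min_le_right _ _,
      fun N n hn => (min_le_left _ _).trans (h N n hn)⟩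
  have hlim := (tendsto_measureReal_not_exists_isPMAllocation hmeas hindep hident hb hε).add
    (tendsto_mul_two_pow_feedbackSize hb hε hq hqS.1)
  rw [add_zero] at hlim
  refine squeeze_zero' (.of_forall fun _ => measureReal_nonneg) ?_ hlim
  filter_upwards [hS] with N hN
  set M := feedbackSize b ε N
  -- When a matching exists and each user has `M` gains above `L`, all allocated gains exceed `L`,
  -- as they are among the `M` best.
  have hsub : {ω | ¬∀ n ∈ S N,
      0 < equalPowerRate b Pmax N₀ (fun k => g n k ω) (A N ω n) ∧
      equalPowerRate b Pmax N₀ (fun k => g n k ω) (A N ω n) ≤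
        waterFillingRate Pmax N₀ (fun k => g n k ω) (A N ω n) ∧
      waterFillingRate Pmax N₀ (fun k => g n k ω) (A N ω n) <
        (1 + δ) * equalPowerRate b Pmax N₀ (fun k => g n k ω) (A N ω n)} ⊆
      {ω | ¬∃ B, IsPMAllocation b N M (fun n k => g n k ω) B} ∪
        ⋃ n ∈ S N, {ω | #{k ∈ range (b * N) | L < g n k ω} < M} := fun ω hω => by
    by_contra hω'
    simp only [Set.mem_union, Set.mem_iUnion, Set.mem_ofPred_eq, not_or, not_exists, not_lt] at hω'
    obtain ⟨hPM, hcard⟩ := hω'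
    have hPM' := hA N ω (not_forall_not.1 hPM)
    refine hω fun n hn => ?_
    have hnN := mem_range.1 (hN hn)
    exact hL _ _ (hPM'.card_eq n hnN) fun k hk =>
      (hPM'.isMBest n hnN k hk).lt_of_le_card (hcard n hn)
  refine (measureReal_mono hsub (measure_ne_top _ _)).trans ((measureReal_union_le _ _).trans
    (add_le_add le_rfl ((measureReal_biUnion_finset_le _ _).trans ?_)))
  have hqle : ∀ n, (μ.map (g n 0)).real (Set.Ioi L) ≤ 1 := fun n => by
    have : IsProbabilityMeasure (μ.map (g n 0)) :=
      Measure.isProbabilityMeasure_map (hmeas n 0).aemeasurable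
    exact measureReal_le_one
  refine (sum_le_card_nsmul _ _ (2 ^ M * (1 - q / 2) ^ (b * N)) fun n hn => ?_).trans ?_
  · refine (measureReal_card_lt_le hmeas hindep hident n (b * N) M L).trans ?_
    have h1 := hqle n
    have h2 := hqS.2 N n hn
    gcongr
    linarith
  · have h1 : 0 ≤ 1 - q / 2 := by linarith [hqS.1]
    have h2 : #(S N) ≤ N := by simpa using card_le_card hN
    rw [nsmul_eq_mul]
    gcongr

end Tail

theorem abs_div_sub_one_lt {x y δ : ℝ} (hy : 0 < y) (hyx : y ≤ x) (hx : x < (1 + δ) * y) :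
    |x / y - 1| < δ := by
  rw [abs_of_nonneg (sub_nonneg.2 ((one_le_div hy).2 hyx)), sub_lt_iff_lt_add', div_lt_iff₀ hy]
  exact hx

end WaterFilling

open WaterFilling in
theorem corollary1
    {Ω : Type*} [MeasurableSpace Ω] (μ : Measure Ω) [IsProbabilityMeasure μ]
    (b : ℕ) (hb : 0 < b) (ε : ℝ) (hε : 0 < ε)
    (Pmax N₀ : ℝ) (hPmax : 0 < Pmax) (hN₀ : 0 < N₀)
    -- `g n k` is the gain of user `n` in channel `k`
    (g : ℕ → ℕ → Ω → ℝ)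
    (hmeas : ∀ n k, Measurable (g n k))
    (hindep : iIndepFun (fun p : ℕ × ℕ => g p.1 p.2) μ)
    (hident : ∀ n k l, IdentDistrib (g n k) (g n l) μ μ)
    (htail : ∀ n k, HasExpDominatedTail (μ.map (g n k)))
    -- `A N ω n` is the set of channels of user `n` in the system with `N` users, `b * N` channels
    (A : ℕ → Ω → ℕ → Finset ℕ)
    (hA : ∀ N ω,
      (∃ B, IsPMAllocation b N (feedbackSize b ε N) (fun n k => g n k ω) B) →
        IsPMAllocation b N (feedbackSize b ε N) (fun n k => g n k ω) (A N ω)) :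
    -- each user
    (∀ n : ℕ, TendstoInMeasure μ
      (fun (N : ℕ) ω => waterFillingRate Pmax N₀ (fun k => g n k ω) (A N ω n) /
        equalPowerRate b Pmax N₀ (fun k => g n k ω) (A N ω n))
      atTop (fun _ => (1 : ℝ))) ∧
    -- all users at once, and the sum-rate, for finitely many classes of users
    ((Set.range fun n => μ.map (g n 0)).Finite →
      (∀ δ : ℝ, 0 < δ → Tendsto
        (fun N : ℕ => μ {ω | ∃ n < N,
          δ ≤ |waterFillingRate Pmax N₀ (fun k => g n k ω) (A N ω n) /
            equalPowerRate b Pmax N₀ (fun k => g n k ω) (A N ω n) - 1|})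
        atTop (𝓝 0)) ∧
      TendstoInMeasure μ
        (fun (N : ℕ) ω =>
          (∑ n ∈ Finset.range N, waterFillingRate Pmax N₀ (fun k => g n k ω) (A N ω n)) /
            ∑ n ∈ Finset.range N, equalPowerRate b Pmax N₀ (fun k => g n k ω) (A N ω n))
        atTop (fun _ => (1 : ℝ))) := by
  have hpos : ∀ n L, 0 < (μ.map (g n 0)).real (Set.Ioi L) := fun n L => by
    have : IsProbabilityMeasure (μ.map (g n 0)) :=
      Measure.isProbabilityMeasure_map (hmeas n 0).aemeasurable
    exact (htail n 0).measureReal_Ioi_pos L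
  refine ⟨fun n => ?_, fun hfin => ?_⟩
  · rw [tendstoInMeasure_iff_measureReal_dist]
    intro δ hδ
    refine squeeze_zero (fun _ => measureReal_nonneg) (fun N => ?_)
      (tendsto_measureReal_not_rates_close hmeas hindep hident hb hε hPmax hN₀ hA
        (S := fun _ => {n}) ?_ (fun L => ⟨_, hpos n L, fun N m hm => ?_⟩) hδ)
    · refine measureReal_mono (fun ω hω h => ?_) (measure_ne_top _ _)
      obtain ⟨h1, h2, h3⟩ := h n (mem_singleton_self n)
      exact absurd (abs_div_sub_one_lt h1 h2 h3) (not_lt.2 hω)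
    · filter_upwards [eventually_gt_atTop n] with N hN
      simpa using hN
    · rw [mem_singleton.1 hm]
  · have htail' : ∀ L, ∃ q > 0, ∀ N, ∀ n ∈ range N, q ≤ (μ.map (g n 0)).real (Set.Ioi L) := by
      intro L
      -- Among finitely many laws, one with the smallest tail at `L` gives a bound `q` valid for all
      -- users.
      obtain ⟨_, ⟨m, rfl⟩, hm⟩ := hfin.exists_minimalFor (fun ν : Measure ℝ => ν.real (Set.Ioi L)) _
        (Set.range_nonempty _)
      refine ⟨_, hpos m L, fun N n _ => ?_⟩
      rcases le_total ((μ.map (g m 0)).real (Set.Ioi L)) ((μ.map (g n 0)).real (Set.Ioi L))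
        with h | h
      · exact h
      · exact hm ⟨n, rfl⟩ h
    have hlim : ∀ δ : ℝ, 0 < δ → _ := fun δ hδ =>
      tendsto_measureReal_not_rates_close hmeas hindep hident hb hε hPmax hN₀ hA
        (S := range) (.of_forall fun _ => Subset.rfl) htail' hδ
    constructor
    · intro δ hδ
      rw [← ENNReal.tendsto_toReal_zero_iff fun _ => measure_ne_top _ _]
      refine squeeze_zero (fun _ => measureReal_nonneg) (fun N => ?_) (hlim δ hδ)
      refine measureReal_mono (fun ω hω h => ?_) (measure_ne_top _ _)
      obtain ⟨n, hn, hω⟩ := hω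
      obtain ⟨h1, h2, h3⟩ := h n (mem_range.2 hn)
      exact absurd (abs_div_sub_one_lt h1 h2 h3) (not_lt.2 hω)
    · rw [tendstoInMeasure_iff_measureReal_dist]
      intro δ hδ
      refine squeeze_zero' (.of_forall fun _ => measureReal_nonneg) ?_ (hlim δ hδ)
      -- The termwise bounds add up to bounds for the sums. For `N = 0` the quotient is `0 / 0 = 0`,
      -- so this case is left out.
      filter_upwards [eventually_gt_atTop 0] with N hN
      refine measureReal_mono (fun ω hω h => ?_) (measure_ne_top _ _)
      have hne : (range N).Nonempty := nonempty_range_iff.2 hN.ne'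
      refine absurd (abs_div_sub_one_lt (sum_pos (fun n hn => (h n hn).1) hne)
        (sum_le_sum fun n hn => (h n hn).2.1) ?_) (not_lt.2 hω)
      rw [mul_sum]
      exact sum_lt_sum_of_nonempty hne fun n hn => (h n hn).2.2
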